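/- Let $J\in C^2(\mathbb R^n;\mathbb R)$ and, for $s=1,2$ and $i=1,\dots,n$, let $F_{si}\in C^1(\mathbb R;\mathbb R)$. Suppose that for each $i$ there is a continuous $F_{0i}:\mathbb R\to\mathbb R$ such that $$F_{2i}(z)=-F_{1i}(z)\int\frac{F_{0i}(z)}{F_{1i}(z)^2}\,dz ,$$ in the following sense: $F_{1i}$ has at most countably many zeros, all of them isolated; off these zeros $F_{2i}=-F_{1i}\Psi_i$ for some antiderivative $\Psi_i$ of $F_{0i}/F_{1i}^2$; and $F_{2i}(z^*)=-\lim_{z\to z^*}F_{1i}(z)\Psi_i(z)$ at each zero $z^*$ of $F_{1i}$. Let $\tilde u_{si}:\mathbb R\to\mathbb R$ be continuous and $T$-periodic for a common $T>0$, with $\int_0^T\tilde u_{si}(\tau)\,d\tau=0$, and define $\beta_{si,rk}$ by $$\int_0^T\!\int_0^\theta \tilde u_{si}(\theta)\tilde u_{rk}(\tau)\,d\tau\,d\theta=\beta_{si,rk}T .$$ Assume that inputs of different coordinates do not interact: $\beta_{si,rk}=0$ for all $s,r\in\{1,2\}$ whenever $i\ne k$. For $\omega>0$ put $u_{si}(t)=\sqrt\omega\,\tilde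 u_{si}(\omega t)$ and consider $$\dot x=\sum_{i=1}^n\big(F_{1i}(J(x))u_{1i}(t)+F_{2i}(J(x))u_{2i}(t)\big)e_i,\qquad x\in\mathbb R^n. \tag{1}$$ For a system $\dot x=f_0(x)+\sum_{j}f_j(x)\sqrt\omega\,\tilde u_j(\omega t)$ the Lie bracket system is $\dot{\bar x}=f_0(\bar x)+\sum_{i<j}\beta_{j,i}[f_i,f_j](\bar x)$, where $[f,g](x)=Dg(x)f(x)-Df(x)g(x)$. Then the Lie bracket system for (1) (with drift $0$ and the $2n$ vector fields $F_{si}(J(\cdot))e_i$) is $$\dot{\bar x}=-\sum_{i=1}^n\beta_{2i,1i}\,\frac{\partial J(\bar x)}{\partial \bar x_i}\,F_{0i}(J(\bar x))\,e_i . \tag{2}$$ Moreover, if all $F_{si}\in C^2(\mathbb R;\mathbb R)$ and a compact set $S\subset\mathbb R^n$ is locally (respectively globally) uniformly asymptotically stable for (2), then $S$ is locally (respectively semi-globally) practically uniformly asymptotically stable for (1). Here $B_\delta(S)$ is the open $\delta$-neighbourhood of $S$. The set $S$ is practically uniformly stable for (1) if for every $\varepsilon>0$ there are $\delta>0$ and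 $\omega_0>0$ such that for all $t_0\ge0$, $\omega>\omega_0$ and $x(t_0)\in B_\delta(S)$ the solution exists and satisfies $x(t)\in B_\varepsilon(S)$ for all $t\ge t_0$. It is $\hat\delta$-practically uniformly attractive if for every $\varepsilon>0$ there are $t_1\ge0$ and $\omega_0>0$ such that for all $t_0\ge0$, $\omega>\omega_0$ and $x(t_0)\in B_{\hat\delta}(S)$ the solution exists for all $t\ge t_0$ and satisfies $x(t)\in B_\varepsilon(S)$ for all $t\ge t_0+t_1$. Local (semi-global) practical uniform asymptotic stability is practical uniform stability together with $\hat\delta$-practical uniform attractivity for some (every) $\hat\delta>0$. Local (global) uniform asymptotic stability for (2) is defined in the same way with $\omega$ and $\omega_0$ omitted. -/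

import Mathlib

noncomputable section

namespace LieBracketES

/-! ### Solutions and stability notions -/

section Stability

variable {E : Type*} [NormedAddCommGroup E] [NormedSpace ℝ E]

/-- `x` is a solution of `ẋ = g(t, x)` on the whole half-line `[t₀, ∞)` with `x(t₀) = x₀`. -/
def IsSolution (g : ℝ → E → E) (t₀ : ℝ) (x₀ : E) (x : ℝ → E) : Prop :=
  x t₀ = x₀ ∧ ∀ t, t₀ ≤ t → HasDerivWithinAt x (g t (x t)) (Set.Ici t₀) t

/-- The solution of `ẋ = g(t, x)`, `x(t₀) = x₀` exists for all `t ≥ t₀`, and it lies in the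
`ε`-neighbourhood of `S` for all `t ≥ t₀ + t₁`. -/
def SolutionIn (g : ℝ → E → E) (S : Set E) (t₀ : ℝ) (x₀ : E) (t₁ ε : ℝ) : Prop :=
  (∃ x, IsSolution g t₀ x₀ x) ∧
    ∀ x, IsSolution g t₀ x₀ x → ∀ t, t₀ + t₁ ≤ t → x t ∈ Metric.thickening ε S

/-- Uniform stability of `S` for `ẋ = g(t, x)`. -/
def UniformlyStable (g : ℝ → E → E) (S : Set E) : Prop :=
  ∀ ε > 0, ∃ δ > 0, ∀ t₀ ≥ 0, ∀ x₀ ∈ Metric.thickening δ S, SolutionIn g S t₀ x₀ 0 ε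

/-- `δ'`-uniform attractivity of `S` for `ẋ = g(t, x)`. -/
def UniformlyAttractive (g : ℝ → E → E) (S : Set E) (δ' : ℝ) : Prop :=
  ∀ ε > 0, ∃ t₁ ≥ 0, ∀ t₀ ≥ 0, ∀ x₀ ∈ Metric.thickening δ' S, SolutionIn g S t₀ x₀ t₁ ε

/-- Local uniform asymptotic stability. -/
def LocallyUAS (g : ℝ → E → E) (S : Set E) : Prop :=
  UniformlyStable g S ∧ ∃ δ' > 0, UniformlyAttractive g S δ'

/-- Global uniform asymptotic stability. -/
def GloballyUAS (g : ℝ → E → E) (S : Set E) : Prop :=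
  UniformlyStable g S ∧ ∀ δ' > 0, UniformlyAttractive g S δ'

/-- Practical uniform stability of `S` for the family `ẋ = g(ω, t, x)`, `ω > 0`. -/
def PracticallyUniformlyStable (g : ℝ → ℝ → E → E) (S : Set E) : Prop :=
  ∀ ε > 0, ∃ δ > 0, ∃ ω₀ > 0, ∀ t₀ ≥ 0, ∀ ω > ω₀, ∀ x₀ ∈ Metric.thickening δ S,
    SolutionIn (g ω) S t₀ x₀ 0 ε

/-- `δ'`-practical uniform attractivity of `S` for the family `ẋ = g(ω, t, x)`, `ω > 0`. -/
def PracticallyUniformlyAttractive (g : ℝ → ℝ → E → E) (S : Set E) (δ' : ℝ) : Prop :=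
  ∀ ε > 0, ∃ t₁ ≥ 0, ∃ ω₀ > 0, ∀ t₀ ≥ 0, ∀ ω > ω₀, ∀ x₀ ∈ Metric.thickening δ' S,
    SolutionIn (g ω) S t₀ x₀ t₁ ε

/-- Local practical uniform asymptotic stability. -/
def LocallyPracticallyUAS (g : ℝ → ℝ → E → E) (S : Set E) : Prop :=
  PracticallyUniformlyStable g S ∧ ∃ δ' > 0, PracticallyUniformlyAttractive g S δ'

/-- Semi-global practical uniform asymptotic stability. -/
def SemiGloballyPracticallyUAS (g : ℝ → ℝ → E → E) (S : Set E) : Prop :=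
  PracticallyUniformlyStable g S ∧ ∀ δ' > 0, PracticallyUniformlyAttractive g S δ'

end Stability

/-! ### Control-affine systems and their Lie bracket systems -/

section ControlAffine

variable {E : Type*} [NormedAddCommGroup E] [NormedSpace ℝ E]
variable {ι : Type*} [Fintype ι]

/-- The inputs `u_j` are continuous, `T`-periodic, of zero mean over a period, and
`∫₀ᵀ ∫₀^θ u_i(θ) u_j(τ) dτ dθ = β_{i,j} T`. -/
structure AdmissibleInputs (T : ℝ) (β : ι → ι → ℝ) (u : ι → ℝ → ℝ) : Prop where
  period_pos : 0 < T
  continuous : ∀ i, Continuous (u i)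
  periodic : ∀ i, Function.Periodic (u i) T
  mean_zero : ∀ i, ∫ τ in (0 : ℝ)..T, u i τ = 0
  beta_eq : ∀ i j, ∫ θ in (0 : ℝ)..T, ∫ τ in (0 : ℝ)..θ, u i θ * u j τ = β i j * T

/-- Right-hand side of the control-affine system
`ẋ = f₀(x) + ∑_j f_j(x) √ω u_j(ω t)`. -/
def controlAffineField (f₀ : E → E) (f : ι → E → E) (u : ι → ℝ → ℝ) (ω t : ℝ) (x : E) : E :=
  f₀ x + ∑ j, (√ω * u j (ω * t)) • f j x

/-- Right-hand side of the Lie bracket system `ẋ = f₀(x) + ∑_{i<j} β_{j,i} [f_i, f_j](x)` of the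
control-affine system, where `[f, g](x) = Dg(x) f(x) - Df(x) g(x)`. -/
def lieBracketField [LinearOrder ι] (f₀ : E → E) (f : ι → E → E) (β : ι → ι → ℝ) (x : E) : E :=
  f₀ x + ∑ i, ∑ j with i < j, β j i • VectorField.lieBracket ℝ (f i) (f j) x

end ControlAffine

/-! ### The class of vector fields and the extremum seeking system -/

/-- The relation `F₂(z) = -F₁(z) ∫ F₀(z) / F₁(z)² dz`: `F₁` vanishes at most on a countable set of
isolated zeros, `Ψ` is an antiderivative of `F₀ / F₁²` off the zeros of `F₁`, where
`F₂ = -F₁ Ψ`, and at a zero of `F₁` the value of `F₂` is the limit of `-F₁ Ψ`. -/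
def ClassRelation (F₀ F₁ F₂ : ℝ → ℝ) : Prop :=
  {z | F₁ z = 0}.Countable ∧
  (∀ z, F₁ z = 0 → ∀ᶠ w in nhdsWithin z {z}ᶜ, F₁ w ≠ 0) ∧
  ∃ Ψ : ℝ → ℝ,
    (∀ z, F₁ z ≠ 0 → HasDerivAt Ψ (F₀ z / F₁ z ^ 2) z ∧ F₂ z = -(F₁ z * Ψ z)) ∧
    (∀ z, F₁ z = 0 →
      Filter.Tendsto (fun w => -(F₁ w * Ψ w)) (nhdsWithin z {z}ᶜ) (nhds (F₂ z)))

/-- Indices `(s, i)` of the `2n` inputs, ordered lexicographically; `s = 0, 1` stands for the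
first subscript `1, 2`. -/
abbrev InputIndex (n : ℕ) : Type := Fin 2 ×ₗ Fin n

/-- The index `(s, i)`. -/
abbrev idx {n : ℕ} (s : Fin 2) (i : Fin n) : InputIndex n := toLex (s, i)

/-- The `i`-th unit vector. -/
abbrev unitVec {n : ℕ} (i : Fin n) : EuclideanSpace ℝ (Fin n) := EuclideanSpace.single i 1

/-- The control vector fields `f_{si}(x) = F_{si}(J(x)) e_i`. -/
def esVectorField {n : ℕ} (J : EuclideanSpace ℝ (Fin n) → ℝ) (F : Fin 2 → Fin n → ℝ → ℝ)
    (p : InputIndex n) (x : EuclideanSpace ℝ (Fin n)) : EuclideanSpace ℝ (Fin n) :=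
  F (ofLex p).1 (ofLex p).2 (J x) • unitVec (ofLex p).2

/-- Right-hand side of
`ẋ = ∑_i (F_{1i}(J(x)) u_{1i}(t) + F_{2i}(J(x)) u_{2i}(t)) e_i`, for inputs `u_{si}`. -/
def esField {n : ℕ} (J : EuclideanSpace ℝ (Fin n) → ℝ) (F : Fin 2 → Fin n → ℝ → ℝ)
    (u : InputIndex n → ℝ → ℝ) (t : ℝ) (x : EuclideanSpace ℝ (Fin n)) :
    EuclideanSpace ℝ (Fin n) :=
  ∑ i, (F 0 i (J x) * u (idx 0 i) t + F 1 i (J x) * u (idx 1 i) t) • unitVec i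

/-- The inputs `u_{si}(t) = √ω ũ_{si}(ω t)`. -/
def scaledInput {ι : Type*} (u : ι → ℝ → ℝ) (ω : ℝ) (p : ι) (t : ℝ) : ℝ :=
  √ω * u p (ω * t)

/-- Right-hand side of the gradient-like system
`ẋ = -∑_i β_{2i,1i} ∂J/∂x_i(x) F_{0i}(J(x)) e_i`. -/
def gradientLikeField {n : ℕ} (J : EuclideanSpace ℝ (Fin n) → ℝ) (F₀ : Fin n → ℝ → ℝ)
    (β : InputIndex n → InputIndex n → ℝ) (x : EuclideanSpace ℝ (Fin n)) :
    EuclideanSpace ℝ (Fin n) :=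
  -∑ i, (β (idx 1 i) (idx 0 i) * fderiv ℝ J x (unitVec i) * F₀ i (J x)) • unitVec i

/-- With the scaled inputs, the extremum seeking system is the control-affine system with zero
drift, vector fields `F_{si}(J(x)) e_i` and inputs `ũ_{si}`. -/
theorem esField_eq_controlAffineField {n : ℕ} (J : EuclideanSpace ℝ (Fin n) → ℝ)
    (F : Fin 2 → Fin n → ℝ → ℝ) (u : InputIndex n → ℝ → ℝ) (ω t : ℝ)
    (x : EuclideanSpace ℝ (Fin n)) :
    esField J F (scaledInput u ω) t x =
      controlAffineField (fun _ => 0) (esVectorField J F) u ω t x := by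
  have h : ∑ j : InputIndex n, (√ω * u j (ω * t)) • esVectorField J F j x =
      ∑ q : Fin 2 × Fin n, (√ω * u (toLex q) (ω * t)) • esVectorField J F (toLex q) x :=
    (Equiv.sum_comp (toLex : Fin 2 × Fin n ≃ InputIndex n) _).symm
  unfold esField controlAffineField
  rw [h, Fintype.sum_prod_type, Fin.sum_univ_two, ← Finset.sum_add_distrib, zero_add]
  refine Finset.sum_congr rfl fun i _ => ?_
  simp only [esVectorField, scaledInput, ofLex_toLex, smul_smul, ← add_smul]
  congr 1
  ring

end LieBracketES

end

/-!
The bracket identity is a computation: `[f_{1i}, f_{2i}]` is `∂_i J` times the Wronskian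
`F₁ F₂' - F₁' F₂` at `J(x)`, which the class relation makes equal to `-F₀`
(`ClassRelation.wronskian`), and the brackets of fields in different coordinates come with the
coefficient zero.

For the stability transfer, write `U_j` for the primitive of `u_j` and `W_{jk}` for that of
`U_j u_k - β_{k,j}`; both are periodic, hence bounded. If `x` solves the control-affine system, then
`z = x - ω^{-1/2} ∑ U_j(ωt) f_j(x) + ω⁻¹ ∑ W_{jk}(ωt) Df_j(x) f_k(x)` satisfies
`ż = -∑ β_{k,j} Df_j(x) f_k(x) + O(ω^{-1/2})` as long as `x` stays in a bounded set
(`AdmissibleInputs.hasDerivWithinAt_nearIdentity`). Since `β` is antisymmetric, the leading term is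
the Lie bracket field (`lieBracketField_eq_averagedField`). Grönwall's inequality and a bootstrap
then show that, uniformly in the initial time, solutions follow those of the Lie bracket system on
compact time intervals once `ω` is large (`AdmissibleInputs.exists_tracking`).

Uniform asymptotic stability of the limit system upgrades this to all times: after the contraction
time a tracking solution is back in the neighbourhood of `S` where it started, and the argument can
be repeated (`TracksOnCompacts.exists_trapping`). All these estimates hold for solutions on
arbitrary compact intervals, so they also serve as the a priori bounds under which
`LocallyLipschitzField.exists_isSolution` gives existence on the whole half-line.
-/

noncomputable section

namespace LieBracketES

open Set Filter Topology Metric Function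
open scoped NNReal

/-! ### Continuation of solutions under an a priori bound -/

section Continuation

variable {E : Type*} [NormedAddCommGroup E] [NormedSpace ℝ E]
variable {g : ℝ → E → E}

theorem _root_.IsIntegralCurveOn.hasDerivWithinAt_Ici {x : ℝ → E} {a b t : ℝ}
    (hx : IsIntegralCurveOn x g (Icc a b)) (ht : t ∈ Ico a b) :
    HasDerivWithinAt x (g t (x t)) (Ici t) t :=
  (hx t ⟨ht.1, ht.2.le⟩).mono_of_mem_nhdsWithin
    (mem_of_superset (Icc_mem_nhdsGE ht.2) (Icc_subset_Icc_left ht.1))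

/-- Concatenation of two integral curves. -/
theorem exists_isIntegralCurveOn_append {x y : ℝ → E} {a b c : ℝ} (hab : a ≤ b) (hbc : b ≤ c)
    (hx : IsIntegralCurveOn x g (Icc a b)) (hy : IsIntegralCurveOn y g (Icc b c))
    (hxy : x b = y b) : ∃ z, z a = x a ∧ IsIntegralCurveOn z g (Icc a c) := by
  classical
  have hl : ∀ t ∈ Icc a b, (if t ≤ b then x t else y t) = x t := fun t ht => if_pos ht.2
  have hr : ∀ t ∈ Icc b c, (if t ≤ b then x t else y t) = y t := by
    intro t ht
    rcases ht.1.eq_or_lt with rfl | h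
    · simp [hxy]
    · exact if_neg h.not_ge
  have hl' : ∀ t ∈ Icc a b, HasDerivWithinAt (fun t => if t ≤ b then x t else y t)
      (g t (if t ≤ b then x t else y t)) (Icc a b) t := by
    intro t ht
    rw [hl t ht]
    exact (hx t ht).congr hl (hl t ht)
  have hr' : ∀ t ∈ Icc b c, HasDerivWithinAt (fun t => if t ≤ b then x t else y t)
      (g t (if t ≤ b then x t else y t)) (Icc b c) t := by
    intro t ht
    rw [hr t ht]
    exact (hy t ht).congr hr (hr t ht)
  refine ⟨fun t => if t ≤ b then x t else y t, if_pos hab, fun t ht => ?_⟩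
  rcases lt_trichotomy t b with h | rfl | h
  · exact (hl' t ⟨ht.1, h.le⟩).mono_of_mem_nhdsWithin
      (mem_nhdsWithin.2 ⟨Iio b, isOpen_Iio, h, fun s hs => ⟨hs.2.1, (mem_Iio.1 hs.1).le⟩⟩)
  · rw [← Icc_union_Icc_eq_Icc hab hbc]
    exact (hl' t ⟨hab, le_rfl⟩).union (hr' t ⟨le_rfl, hbc⟩)
  · exact (hr' t ⟨h.le, ht.2⟩).mono_of_mem_nhdsWithin
      (mem_nhdsWithin.2 ⟨Ioi b, isOpen_Ioi, h, fun s hs => ⟨(mem_Ioi.1 hs.1).le, hs.2.2⟩⟩)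

/-- Time-dependent vector fields that are jointly continuous and Lipschitz in space on balls,
uniformly for times in a bounded interval. -/
structure LocallyLipschitzField (g : ℝ → E → E) : Prop where
  continuous : Continuous (uncurry g)
  lipschitz : ∀ a b R : ℝ, ∃ L : ℝ≥0, ∀ t ∈ Icc a b, LipschitzOnWith L (g t) (closedBall 0 R)

variable [ProperSpace E]

/-- Picard-Lindelöf with a uniform time of existence for initial values in a ball. -/
theorem LocallyLipschitzField.exists_uniform_time (hg : LocallyLipschitzField g) (a b R : ℝ) :
    ∃ η > 0, η ≤ 1 ∧ ∀ s ∈ Icc a b, ∀ y ∈ closedBall (0 : E) R,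
      ∃ x, x s = y ∧ IsIntegralCurveOn x g (Icc s (s + η)) := by
  obtain ⟨M, hM⟩ := ((isCompact_Icc (a := a) (b := b + 1)).prod
    (isCompact_closedBall (0 : E) (R + 1))).exists_bound_of_continuousOn hg.continuous.continuousOn
  obtain ⟨L, hL⟩ := hg.lipschitz a (b + 1) (R + 1)
  have hM' : 0 < |M| + 1 := by positivity
  -- a solution of speed at most `|M| + 1` stays within distance `1` of `y` for this long
  refine ⟨(|M| + 1)⁻¹, by positivity, inv_le_one_of_one_le₀ (by linarith [abs_nonneg M]), ?_⟩
  intro s hs y hy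
  set η : ℝ := (|M| + 1)⁻¹
  have hη0 : 0 < η := by positivity
  have hη1 : η ≤ 1 := inv_le_one_of_one_le₀ (by linarith [abs_nonneg M])
  have hball : closedBall y ((1 : ℝ≥0) : ℝ) ⊆ closedBall (0 : E) (R + 1) := by
    refine closedBall_subset_closedBall' ?_
    rw [mem_closedBall] at hy
    simp only [NNReal.coe_one]
    linarith
  have htime : Icc s (s + η) ⊆ Icc a (b + 1) := Icc_subset_Icc hs.1 (by linarith [hs.2])
  have hPL : IsPicardLindelof g (tmin := s) (tmax := s + η) ⟨s, le_rfl, by linarith⟩ y 1 0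
      ⟨|M| + 1, hM'.le⟩ L := by
    refine ⟨fun t ht => (hL t (htime ht)).mono hball, fun x _ => ?_, fun t ht x hx => ?_, ?_⟩
    · exact (hg.continuous.comp (by fun_prop : Continuous fun t : ℝ => (t, x))).continuousOn
    · have := hM (t, x) ⟨htime ht, hball hx⟩
      simp only [uncurry_apply_pair] at this
      exact this.trans ((le_abs_self M).trans (lt_add_one _).le)
    · simp only [add_sub_cancel_left, sub_self, NNReal.coe_one, NNReal.coe_zero,
        sub_zero, max_eq_left hη0.le]
      exact (mul_inv_cancel₀ hM'.ne').le
  exact hPL.exists_eq_forall_mem_Icc_hasDerivWithinAt (by simp)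

/-- If every solution of `ẋ = g(t, x)`, `x(t₀) = x₀` on a compact interval `[t₀, b]` ends in a
fixed ball, then there is a solution on `[t₀, ∞)`. -/
theorem LocallyLipschitzField.exists_isSolution (hg : LocallyLipschitzField g) {t₀ R : ℝ} {x₀ : E}
    (hbound : ∀ b ≥ t₀, ∀ x, x t₀ = x₀ → IsIntegralCurveOn x g (Icc t₀ b) →
      x b ∈ closedBall 0 R) :
    ∃ x, IsSolution g t₀ x₀ x := by
  have hex : ∀ b ≥ t₀, ∃ x, x t₀ = x₀ ∧ IsIntegralCurveOn x g (Icc t₀ b) := by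
    intro b hb
    obtain ⟨η, hη, hη1, hstep⟩ := hg.exists_uniform_time t₀ (b + 1) R
    have hk : ∀ k : ℕ, t₀ + k * η ≤ b + 1 →
        ∃ x, x t₀ = x₀ ∧ IsIntegralCurveOn x g (Icc t₀ (t₀ + k * η)) := by
      intro k
      induction k with
      | zero =>
        intro _
        refine ⟨fun _ => x₀, rfl, ?_⟩
        intro t ht
        simp only [Nat.cast_zero, zero_mul, add_zero, Icc_self] at ht ⊢
        rw [mem_singleton_iff] at ht
        subst ht
        exact HasFDerivWithinAt.of_subsingleton subsingleton_singleton
      | succ k ih =>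
        intro hle
        push_cast at hle ⊢
        have h0 : 0 ≤ k * η := by positivity
        obtain ⟨x, hx0, hx⟩ := ih (by linarith)
        have hxb := hbound _ (by linarith) x hx0 hx
        obtain ⟨y, hy0, hy⟩ := hstep (t₀ + k * η) ⟨by linarith, by linarith⟩ _ hxb
        obtain ⟨z, hz0, hz⟩ := exists_isIntegralCurveOn_append (by linarith) (by linarith) hx hy
          hy0.symm
        refine ⟨z, hz0.trans hx0, ?_⟩
        convert hz using 2
        ring
    have hnn : 0 ≤ (b - t₀) / η := div_nonneg (by linarith) hη.le
    have h1 := Nat.le_ceil ((b - t₀) / η)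
    have h2 := Nat.ceil_lt_add_one hnn
    rw [div_le_iff₀ hη] at h1
    have h3 : (⌈(b - t₀) / η⌉₊ : ℝ) * η ≤ b - t₀ + η := by
      have := mul_le_mul_of_nonneg_right h2.le hη.le
      rwa [add_mul, div_mul_cancel₀ _ hη.ne', one_mul] at this
    obtain ⟨x, hx0, hx⟩ := hk ⌈(b - t₀) / η⌉₊ (by linarith)
    exact ⟨x, hx0, hx.mono (Icc_subset_Icc_right (by linarith))⟩
  have hmem : ∀ b, ∀ x, x t₀ = x₀ → IsIntegralCurveOn x g (Icc t₀ b) →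
      ∀ t ∈ Ico t₀ b, x t ∈ closedBall 0 R := fun b x hx0 hx t ht =>
    hbound t ht.1 x hx0 (hx.mono (Icc_subset_Icc_right ht.2.le))
  have huniq : ∀ b x y, x t₀ = x₀ → y t₀ = x₀ → IsIntegralCurveOn x g (Icc t₀ b) →
      IsIntegralCurveOn y g (Icc t₀ b) → EqOn x y (Icc t₀ b) := by
    intro b x y hx0 hy0 hx hy
    obtain ⟨L, hL⟩ := hg.lipschitz t₀ b R
    exact ODE_solution_unique_of_mem_Icc_right (fun t ht => hL t ⟨ht.1, ht.2.le⟩)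
      hx.continuousOn (fun t ht => hx.hasDerivWithinAt_Ici ht) (hmem b x hx0 hx)
      hy.continuousOn (fun t ht => hy.hasDerivWithinAt_Ici ht) (hmem b y hy0 hy)
      (hx0.trans hy0.symm)
  choose X hX0 hX using fun n : ℕ => hex (t₀ + n) (by simp)
  have heq : ∀ n : ℕ, ∀ t ∈ Icc t₀ (t₀ + n), X ⌈t - t₀⌉₊ t = X n t := by
    intro n t ht
    have h1 := Nat.le_ceil (t - t₀)
    have h2 : ⌈t - t₀⌉₊ ≤ n := Nat.ceil_le.2 (by linarith [ht.2])
    have h2' : ((⌈t - t₀⌉₊ : ℕ) : ℝ) ≤ n := by exact_mod_cast h2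
    exact huniq (t₀ + ⌈t - t₀⌉₊) _ _ (hX0 _) (hX0 _) (hX _)
      ((hX n).mono (Icc_subset_Icc_right (by linarith))) ⟨ht.1, by linarith⟩
  refine ⟨fun t => X ⌈t - t₀⌉₊ t, hX0 _, fun t ht => ?_⟩
  obtain ⟨n, hn⟩ := exists_nat_gt (t - t₀)
  have htn : t ∈ Icc t₀ (t₀ + n) := ⟨ht, by linarith⟩
  have hd := (hX n t htn).congr (heq n) (heq n t htn)
  simp only [heq n t htn]
  exact hd.mono_of_mem_nhdsWithin
    (mem_nhdsWithin.2 ⟨Iio (t₀ + n), isOpen_Iio, by rw [mem_Iio]; linarith,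
      fun s hs => ⟨hs.2, (mem_Iio.1 hs.1).le⟩⟩)

end Continuation

/-! ### Primitives of the inputs -/

section Inputs

variable {ι : Type*} {T : ℝ} {β : ι → ι → ℝ} {u : ι → ℝ → ℝ}

theorem periodic_integral_of_integral_eq_zero {v : ℝ → ℝ} (hv : Continuous v)
    (hp : Periodic v T) (h0 : ∫ τ in (0 : ℝ)..T, v τ = 0) :
    Periodic (fun θ => ∫ τ in (0 : ℝ)..θ, v τ) T := by
  intro θ
  have h := hp.intervalIntegral_add_eq θ 0
  rw [zero_add, h0] at h
  simp only
  rw [← intervalIntegral.integral_add_adjacent_intervals (hv.intervalIntegrable 0 θ)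
    (hv.intervalIntegrable θ (θ + T)), h, add_zero]

/-- The primitive `U_j` of the input `u_j`; it is periodic because `u_j` has zero mean. -/
def primitive (u : ι → ℝ → ℝ) (j : ι) (θ : ℝ) : ℝ := ∫ τ in (0 : ℝ)..θ, u j τ

/-- The primitive `W_{jk}` of `U_j u_k - β_{k,j}`; it is periodic because `β_{k,j}` is the mean
of `U_j u_k`. -/
def secondPrimitive (β : ι → ι → ℝ) (u : ι → ℝ → ℝ) (j k : ι) (θ : ℝ) : ℝ :=
  ∫ τ in (0 : ℝ)..θ, (primitive u j τ * u k τ - β k j)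

namespace AdmissibleInputs

theorem hasDerivAt_primitive (hu : AdmissibleInputs T β u) (j : ι) (θ : ℝ) :
    HasDerivAt (primitive u j) (u j θ) θ :=
  intervalIntegral.integral_hasDerivAt_right ((hu.continuous j).intervalIntegrable _ _)
    ((hu.continuous j).stronglyMeasurableAtFilter _ _) (hu.continuous j).continuousAt

theorem continuous_primitive (hu : AdmissibleInputs T β u) (j : ι) : Continuous (primitive u j) :=
  continuous_iff_continuousAt.2 fun θ => (hu.hasDerivAt_primitive j θ).continuousAt

theorem periodic_primitive (hu : AdmissibleInputs T β u) (j : ι) : Periodic (primitive u j) T :=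
  periodic_integral_of_integral_eq_zero (hu.continuous j) (hu.periodic j) (hu.mean_zero j)

theorem primitive_period (hu : AdmissibleInputs T β u) (j : ι) : primitive u j T = 0 :=
  hu.mean_zero j

theorem primitive_zero (j : ι) : primitive u j 0 = 0 :=
  intervalIntegral.integral_same

theorem integral_primitive_mul (hu : AdmissibleInputs T β u) (j k : ι) :
    ∫ θ in (0 : ℝ)..T, primitive u j θ * u k θ = β k j * T := by
  rw [← hu.beta_eq k j]
  refine intervalIntegral.integral_congr fun θ _ => ?_
  simp only [primitive]
  rw [intervalIntegral.integral_const_mul, mul_comm]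

theorem continuous_secondPrimitive_integrand (hu : AdmissibleInputs T β u) (j k : ι) :
    Continuous fun θ => primitive u j θ * u k θ - β k j :=
  ((hu.continuous_primitive j).mul (hu.continuous k)).sub continuous_const

theorem hasDerivAt_secondPrimitive (hu : AdmissibleInputs T β u) (j k : ι) (θ : ℝ) :
    HasDerivAt (secondPrimitive β u j k) (primitive u j θ * u k θ - β k j) θ :=
  intervalIntegral.integral_hasDerivAt_right
    ((hu.continuous_secondPrimitive_integrand j k).intervalIntegrable _ _)
    ((hu.continuous_secondPrimitive_integrand j k).stronglyMeasurableAtFilter _ _)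
    (hu.continuous_secondPrimitive_integrand j k).continuousAt

theorem continuous_secondPrimitive (hu : AdmissibleInputs T β u) (j k : ι) :
    Continuous (secondPrimitive β u j k) :=
  continuous_iff_continuousAt.2 fun θ => (hu.hasDerivAt_secondPrimitive j k θ).continuousAt

theorem periodic_secondPrimitive (hu : AdmissibleInputs T β u) (j k : ι) :
    Periodic (secondPrimitive β u j k) T := by
  refine periodic_integral_of_integral_eq_zero (hu.continuous_secondPrimitive_integrand j k)
    (fun θ => ?_) ?_
  · simp only [hu.periodic_primitive j θ, hu.periodic k θ]
  · have h := intervalIntegral.integral_sub (f := fun θ => primitive u j θ * u k θ)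
      (g := fun _ => β k j) (a := 0) (b := T) (μ := MeasureTheory.volume)
      (((hu.continuous_primitive j).mul (hu.continuous k)).intervalIntegrable _ _)
      (continuous_const.intervalIntegrable _ _)
    rw [h, hu.integral_primitive_mul, intervalIntegral.integral_const]
    simp [mul_comm]

/-- `U_j U_k` vanishes at both ends of a period, so the means of `U_j u_k` and `U_k u_j` are
opposite. -/
theorem beta_antisymm (hu : AdmissibleInputs T β u) (j k : ι) : β j k = -β k j := by
  have h := intervalIntegral.integral_deriv_mul_eq_sub (a := 0) (b := T)
    (fun θ _ => hu.hasDerivAt_primitive j θ) (fun θ _ => hu.hasDerivAt_primitive k θ)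
    ((hu.continuous j).intervalIntegrable _ _) ((hu.continuous k).intervalIntegrable _ _)
  have hadd := intervalIntegral.integral_add (f := fun θ => u j θ * primitive u k θ)
    (g := fun θ => primitive u j θ * u k θ) (a := 0) (b := T) (μ := MeasureTheory.volume)
    (((hu.continuous j).mul (hu.continuous_primitive k)).intervalIntegrable _ _)
    (((hu.continuous_primitive j).mul (hu.continuous k)).intervalIntegrable _ _)
  rw [hu.primitive_period, primitive_zero, hadd, hu.integral_primitive_mul] at h
  have h' := hu.integral_primitive_mul k j
  simp only [mul_comm (primitive u k _)] at h'
  rw [h', zero_mul, zero_mul, sub_zero, ← add_mul] at h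
  have := (mul_eq_zero.1 h).resolve_right hu.period_pos.ne'
  linarith

end AdmissibleInputs

end Inputs

/-! ### The averaged field and the near-identity transformation -/

section Averaging

variable {E : Type*} [NormedAddCommGroup E] [NormedSpace ℝ E]
variable {ι : Type*} {T : ℝ} {β : ι → ι → ℝ} {u : ι → ℝ → ℝ} {f : ι → E → E}

/-- The derivative `Df_j(x) f_k(x)` of `f_j` along `f_k`. -/
def derivAlong (f : ι → E → E) (j k : ι) (x : E) : E := fderiv ℝ (f j) x (f k x)

theorem contDiff_derivAlong (hf : ∀ j, ContDiff ℝ 2 (f j)) (j k : ι) :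
    ContDiff ℝ 1 (derivAlong f j k) :=
  ((hf j).fderiv_right (by norm_num)).clm_apply ((hf k).of_le (by norm_num))

variable [Fintype ι]

/-- The average `-∑_{j,k} β_{k,j} Df_j f_k` of the control-affine system without drift. -/
def averagedField (f : ι → E → E) (β : ι → ι → ℝ) (x : E) : E :=
  -∑ j, ∑ k, β k j • derivAlong f j k x

theorem lieBracketField_eq_averagedField [LinearOrder ι] (hβ : ∀ j k, β j k = -β k j) (x : E) :
    lieBracketField (fun _ => 0) f β x = averagedField f β x := by
  have hsplit : ∀ i j, β j i • derivAlong f i j x =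
      (if i < j then β j i • derivAlong f i j x else 0) +
        (if j < i then β j i • derivAlong f i j x else 0) := by
    intro i j
    rcases lt_trichotomy i j with h | rfl | h
    · simp [h, h.not_gt]
    · have : β i i = 0 := by linarith [hβ i i]
      simp [this]
    · simp [h, h.not_gt]
  have hcomm : ∑ i, ∑ j, (if j < i then β j i • derivAlong f i j x else 0) =
      ∑ i, ∑ j, (if i < j then β i j • derivAlong f j i x else 0) := Finset.sum_comm
  have hsum : ∑ i, ∑ j, β j i • derivAlong f i j x =
      ∑ i, ∑ j, (if i < j then β j i • derivAlong f i j x + β i j • derivAlong f j i x else 0) := by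
    rw [Finset.sum_congr rfl fun i _ => Finset.sum_congr rfl fun j _ => hsplit i j]
    simp only [Finset.sum_add_distrib]
    rw [hcomm]
    simp only [← Finset.sum_add_distrib]
    refine Finset.sum_congr rfl fun i _ => Finset.sum_congr rfl fun j _ => ?_
    split_ifs <;> simp
  simp only [lieBracketField, averagedField, zero_add]
  rw [hsum, ← Finset.sum_neg_distrib]
  refine Finset.sum_congr rfl fun i _ => ?_
  rw [Finset.sum_filter, ← Finset.sum_neg_distrib]
  refine Finset.sum_congr rfl fun j _ => ?_
  split_ifs
  · rw [hβ i j, VectorField.lieBracket, derivAlong, derivAlong, smul_sub, neg_smul]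
    abel
  · simp

theorem contDiff_averagedField (hf : ∀ j, ContDiff ℝ 2 (f j)) :
    ContDiff ℝ 1 (averagedField f β) :=
  (ContDiff.sum fun j _ => ContDiff.sum fun k _ =>
    contDiff_const.smul (contDiff_derivAlong hf j k)).neg

/-- The term `∑_j U_j(θ) f_j(x)` of order `ω^{-1/2}` in the near-identity transformation. -/
def firstCorrector (f : ι → E → E) (u : ι → ℝ → ℝ) (θ : ℝ) (x : E) : E :=
  ∑ j, primitive u j θ • f j x

/-- The term `∑_{j,k} W_{jk}(θ) Df_j(x) f_k(x)` of order `ω⁻¹` in the near-identity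
transformation. -/
def secondCorrector (f : ι → E → E) (β : ι → ι → ℝ) (u : ι → ℝ → ℝ) (θ : ℝ) (x : E) : E :=
  ∑ j, ∑ k, secondPrimitive β u j k θ • derivAlong f j k x

/-- The remainder `∑_{j,k,l} W_{jk}(θ) u_l(θ) D(Df_j f_k)(x) f_l(x)` of order `ω^{-1/2}` in the
transformed equation. -/
def remainder (f : ι → E → E) (β : ι → ι → ℝ) (u : ι → ℝ → ℝ) (θ : ℝ) (x : E) : E :=
  ∑ j, ∑ k, ∑ l, (secondPrimitive β u j k θ * u l θ) • fderiv ℝ (derivAlong f j k) x (f l x)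

/-- The near-identity transformation `z = x - ω^{-1/2} ∑ U_j f_j + ω⁻¹ ∑ W_{jk} Df_j f_k`, with
`U_j` and `W_{jk}` evaluated at `ω t`. -/
def nearIdentity (f : ι → E → E) (β : ι → ι → ℝ) (u : ι → ℝ → ℝ) (ω t : ℝ) (x : E) : E :=
  x - (√ω)⁻¹ • firstCorrector f u (ω * t) x + ω⁻¹ • secondCorrector f β u (ω * t) x

/-- Along solutions of the control-affine system, the near-identity transformation removes the
oscillating terms up to order `ω^{-1/2}`. -/
theorem AdmissibleInputs.hasDerivWithinAt_nearIdentity (hu : AdmissibleInputs T β u)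
    (hf : ∀ j, ContDiff ℝ 2 (f j)) {ω t : ℝ} (hω : 0 < ω) {s : Set ℝ} {x : ℝ → E}
    (hx : HasDerivWithinAt x (controlAffineField (fun _ => 0) f u ω t (x t)) s t) :
    HasDerivWithinAt (fun t => nearIdentity f β u ω t (x t))
      (averagedField f β (x t) + (√ω)⁻¹ • remainder f β u (ω * t) (x t)) s t := by
  have hmul : HasDerivWithinAt (fun t : ℝ => ω * t) ω s t := by
    simpa using (hasDerivWithinAt_id t s).const_mul ω
  have hU : ∀ j, HasDerivWithinAt (fun t => primitive u j (ω * t)) (u j (ω * t) * ω) s t :=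
    fun j => (hu.hasDerivAt_primitive j (ω * t)).comp_hasDerivWithinAt t hmul
  have hW : ∀ j k, HasDerivWithinAt (fun t => secondPrimitive β u j k (ω * t))
      ((primitive u j (ω * t) * u k (ω * t) - β k j) * ω) s t :=
    fun j k => (hu.hasDerivAt_secondPrimitive j k (ω * t)).comp_hasDerivWithinAt t hmul
  have hfx : ∀ j, HasDerivWithinAt (fun t => f j (x t)) (fderiv ℝ (f j) (x t)
      (controlAffineField (fun _ => 0) f u ω t (x t))) s t := fun j =>
    (((hf j).differentiable (by norm_num)) (x t)).hasFDerivAt.comp_hasDerivWithinAt t hx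
  have hgx : ∀ j k, HasDerivWithinAt (fun t => derivAlong f j k (x t))
      (fderiv ℝ (derivAlong f j k) (x t)
      (controlAffineField (fun _ => 0) f u ω t (x t))) s t := fun j k =>
    (((contDiff_derivAlong hf j k).differentiable (by norm_num))
      (x t)).hasFDerivAt.comp_hasDerivWithinAt t hx
  have h1 : HasDerivWithinAt (fun t => firstCorrector f u (ω * t) (x t)) _ s t :=
    HasDerivWithinAt.fun_sum fun j (_ : j ∈ Finset.univ) => (hU j).smul (hfx j)
  have h2 : HasDerivWithinAt (fun t => secondCorrector f β u (ω * t) (x t)) _ s t :=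
    HasDerivWithinAt.fun_sum fun j (_ : j ∈ Finset.univ) =>
      HasDerivWithinAt.fun_sum fun k (_ : k ∈ Finset.univ) => (hW j k).smul (hgx j k)
  refine ((hx.sub (h1.const_smul (√ω)⁻¹)).add (h2.const_smul ω⁻¹)).congr_deriv ?_
  have hs : 0 < √ω := Real.sqrt_pos.2 hω
  have hss : √ω * √ω = ω := Real.mul_self_sqrt hω.le
  have e1 : (√ω)⁻¹ * ω = √ω := by
    rw [inv_mul_eq_iff_eq_mul₀ hs.ne', hss]
  have e2 : ω⁻¹ * √ω = (√ω)⁻¹ := by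
    rw [inv_mul_eq_iff_eq_mul₀ hω.ne', eq_mul_inv_iff_mul_eq₀ hs.ne', hss]
  simp only [controlAffineField, zero_add, map_sum, map_smul, averagedField, remainder,
    derivAlong, Finset.sum_add_distrib, smul_add, Finset.smul_sum, smul_smul, sub_mul, sub_smul,
    Finset.sum_sub_distrib, smul_sub]
  have r1 : ∀ j, (√ω)⁻¹ * (u j (ω * t) * ω) = √ω * u j (ω * t) := fun j => by
    rw [mul_comm (u j _) ω, ← mul_assoc, e1]
  have r2 : ∀ j k, (√ω)⁻¹ * (primitive u j (ω * t) * (√ω * u k (ω * t))) =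
      primitive u j (ω * t) * u k (ω * t) := fun j k => by
    field_simp
  have r3 : ∀ j k, ω⁻¹ * (primitive u j (ω * t) * u k (ω * t) * ω) =
      primitive u j (ω * t) * u k (ω * t) := fun j k => by
    field_simp
  have r4 : ∀ j k, ω⁻¹ * (β k j * ω) = β k j := fun j k => by
    field_simp
  have r5 : ∀ j k l, ω⁻¹ * (secondPrimitive β u j k (ω * t) * (√ω * u l (ω * t))) =
      (√ω)⁻¹ * (secondPrimitive β u j k (ω * t) * u l (ω * t)) := fun j k l => by
    rw [← e2]; ring
  simp only [r1, r2, r3, r4, r5]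
  abel

end Averaging

/-! ### Tracking of solutions of the averaged system -/

section Tracking

variable {E : Type*} [NormedAddCommGroup E] [NormedSpace ℝ E] [ProperSpace E]
variable {ι : Type*} [Fintype ι] {T : ℝ} {β : ι → ι → ℝ} {u : ι → ℝ → ℝ} {f : ι → E → E}

omit [NormedSpace ℝ E] in
theorem exists_bound_of_periodic {Φ : ℝ → E → E} (hΦ : Continuous (uncurry Φ)) (hT : 0 < T)
    (hp : ∀ y, Periodic (fun θ => Φ θ y) T) (R : ℝ) :
    ∃ C ≥ 0, ∀ θ, ∀ y ∈ closedBall (0 : E) R, ‖Φ θ y‖ ≤ C := by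
  obtain ⟨C, hC⟩ := ((isCompact_Icc (a := 0) (b := T)).prod
    (isCompact_closedBall (0 : E) R)).exists_bound_of_continuousOn hΦ.continuousOn
  refine ⟨|C|, abs_nonneg C, fun θ y hy => ?_⟩
  obtain ⟨θ', hθ', h⟩ := (hp y).exists_mem_Ico₀ hT θ
  rw [h]
  exact (hC (θ', y) ⟨Ico_subset_Icc_self hθ', hy⟩).trans (le_abs_self C)

theorem exists_lipschitzOnWith_closedBall_of_contDiff {h : E → E} (hh : ContDiff ℝ 1 h) (R : ℝ) :
    ∃ L : ℝ≥0, LipschitzOnWith L h (closedBall 0 R) :=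
  LocallyLipschitzOn.exists_lipschitzOnWith_of_compact (isCompact_closedBall 0 R)
    (hh.locallyLipschitz.locallyLipschitzOn)

theorem AdmissibleInputs.locallyLipschitzField_controlAffineField (hu : AdmissibleInputs T β u)
    (hf : ∀ j, ContDiff ℝ 1 (f j)) (ω : ℝ) :
    LocallyLipschitzField (controlAffineField (fun _ => 0) f u ω) := by
  have hc : ∀ j, Continuous (f j) := fun j => (hf j).continuous
  have huc := hu.continuous
  refine ⟨?_, fun a b R => ?_⟩
  · unfold controlAffineField
    fun_prop
  · choose L hL using fun j => exists_lipschitzOnWith_closedBall_of_contDiff (hf j) R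
    choose B hB using fun j => (isCompact_Icc (a := a) (b := b)).exists_bound_of_continuousOn
      (f := fun t => √ω * u j (ω * t)) (by fun_prop)
    have hsum : 0 ≤ ∑ j, |B j| * (L j : ℝ) := Finset.sum_nonneg fun j _ => by positivity
    refine ⟨⟨∑ j, |B j| * (L j : ℝ), hsum⟩, fun t ht => ?_⟩
    refine LipschitzOnWith.of_dist_le_mul fun x hx y hy => ?_
    change _ ≤ (∑ j, |B j| * (L j : ℝ)) * dist x y
    simp only [controlAffineField, zero_add, dist_eq_norm]
    rw [← Finset.sum_sub_distrib, Finset.sum_mul]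
    refine (norm_sum_le _ _).trans (Finset.sum_le_sum fun j _ => ?_)
    rw [← smul_sub, norm_smul, mul_assoc]
    have := (hL j).dist_le_mul x hx y hy
    rw [dist_eq_norm, dist_eq_norm] at this
    exact mul_le_mul ((hB j t ht).trans (le_abs_self _)) this (norm_nonneg _) (abs_nonneg _)

/-- On balls, the near-identity transformation moves points by `O(ω^{-1/2})`, and the transformed
equation differs from the averaged one by `O(ω^{-1/2})`. -/
theorem AdmissibleInputs.exists_nearIdentity_bounds (hu : AdmissibleInputs T β u)
    (hf : ∀ j, ContDiff ℝ 2 (f j)) (R : ℝ) :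
    ∃ C ≥ 0, ∀ ω ≥ 1, ∀ t, ∀ y ∈ closedBall (0 : E) R,
      ‖nearIdentity f β u ω t y - y‖ ≤ C * (√ω)⁻¹ ∧
      ‖(√ω)⁻¹ • remainder f β u (ω * t) y‖ ≤ C * (√ω)⁻¹ := by
  have hc : ∀ j, Continuous (f j) := fun j => (hf j).continuous
  have hgc : ∀ j k, Continuous (derivAlong f j k) := fun j k =>
    (contDiff_derivAlong hf j k).continuous
  have hdc : ∀ j k, Continuous (fderiv ℝ (derivAlong f j k)) := fun j k =>
    (contDiff_derivAlong hf j k).continuous_fderiv (by norm_num)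
  have huc := hu.continuous
  have hUc := hu.continuous_primitive
  have hWc := hu.continuous_secondPrimitive
  obtain ⟨C₁, h₁, hC₁⟩ := exists_bound_of_periodic (Φ := firstCorrector f u) (R := R)
    (by unfold firstCorrector; fun_prop) hu.period_pos fun y θ => by
      simp only [firstCorrector, hu.periodic_primitive _ θ]
  obtain ⟨C₂, h₂, hC₂⟩ := exists_bound_of_periodic (Φ := secondCorrector f β u) (R := R)
    (by unfold secondCorrector; fun_prop) hu.period_pos fun y θ => by
      simp only [secondCorrector, hu.periodic_secondPrimitive _ _ θ]
  obtain ⟨C₃, h₃, hC₃⟩ := exists_bound_of_periodic (Φ := remainder f β u) (R := R)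
    (by unfold remainder; fun_prop) hu.period_pos fun y θ => by
      simp only [remainder, hu.periodic_secondPrimitive _ _ θ, hu.periodic _ θ]
  refine ⟨C₁ + C₂ + C₃, by positivity, fun ω hω t y hy => ?_⟩
  have hs1 : 1 ≤ √ω := Real.one_le_sqrt.2 hω
  have hs : 0 < √ω := by linarith
  have hsi : 0 ≤ (√ω)⁻¹ := by positivity
  have hωi : ω⁻¹ ≤ (√ω)⁻¹ := inv_anti₀ hs (Real.sqrt_le_iff.2 ⟨by linarith, by nlinarith⟩)
  have hω0 : 0 ≤ ω⁻¹ := by positivity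
  constructor
  · have : nearIdentity f β u ω t y - y =
        ω⁻¹ • secondCorrector f β u (ω * t) y - (√ω)⁻¹ • firstCorrector f u (ω * t) y := by
      unfold nearIdentity
      abel
    rw [this]
    refine (norm_sub_le _ _).trans ?_
    rw [norm_smul, norm_smul, Real.norm_of_nonneg hsi, Real.norm_of_nonneg hω0]
    have a1 := mul_le_mul_of_nonneg_left (hC₁ (ω * t) y hy) hsi
    have a2 := mul_le_mul hωi (hC₂ (ω * t) y hy) (norm_nonneg _) hsi
    have a3 := mul_nonneg h₃ hsi
    linarith
  · rw [norm_smul, Real.norm_of_nonneg hsi]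
    have a1 := mul_le_mul_of_nonneg_left (hC₃ (ω * t) y hy) hsi
    have a2 := mul_nonneg h₁ hsi
    have a3 := mul_nonneg h₂ hsi
    linarith

/-- If `φ < D` holds at time `0`, and at every time up to which `φ ≤ D`, then it always holds. -/
theorem forall_lt_of_bootstrap {φ : ℝ → ℝ} {τ D : ℝ} (hφ : ContinuousOn φ (Icc 0 τ))
    (h0 : φ 0 < D) (h : ∀ s ∈ Icc 0 τ, (∀ r ∈ Icc 0 s, φ r ≤ D) → φ s < D) :
    ∀ s ∈ Icc 0 τ, φ s < D := by
  by_contra! hcon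
  obtain ⟨s₁, hs₁, hD⟩ := hcon
  have hφ₁ : ContinuousOn φ (Icc 0 s₁) := hφ.mono (Icc_subset_Icc_right hs₁.2)
  have hne : (Icc 0 s₁ ∩ φ ⁻¹' {D}).Nonempty := by
    obtain ⟨r, hr, hr'⟩ := intermediate_value_Icc hs₁.1 hφ₁ ⟨h0.le, hD⟩
    exact ⟨r, hr, hr'⟩
  have hcpt : IsCompact (Icc 0 s₁ ∩ φ ⁻¹' {D}) :=
    isCompact_Icc.of_isClosed_subset
      (hφ₁.preimage_isClosed_of_isClosed isClosed_Icc isClosed_singleton) inter_subset_left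
  -- the first time at which `φ` takes the value `D`
  obtain ⟨s, ⟨hs, hsD⟩, hmin⟩ := hcpt.exists_isLeast hne
  refine absurd hsD (h s ⟨hs.1, hs.2.trans hs₁.2⟩ fun r hr => ?_).ne
  by_contra! hlt
  obtain ⟨r', hr', hr'D⟩ := intermediate_value_Icc hr.1
    (hφ₁.mono (Icc_subset_Icc_right (hr.2.trans hs.2))) ⟨h0.le, hlt.le⟩
  have h1 : s ≤ r' := hmin ⟨⟨hr'.1, hr'.2.trans (hr.2.trans hs.2)⟩, hr'D⟩
  have h2 : r = s := le_antisymm hr.2 (h1.trans hr'.2)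
  rw [h2, show φ s = D from hsD] at hlt
  exact lt_irrefl _ hlt

theorem gronwallBound_mul (c δ K ε x : ℝ) :
    gronwallBound (c * δ) K (c * ε) x = c * gronwallBound δ K ε x := by
  unfold gronwallBound
  split_ifs <;> ring

/-- For large `ω`, solutions of the control-affine system that start close enough to `x̄(0)` stay
`D`-close to the solution `x̄` of the averaged system on a given compact time interval, uniformly
in the initial time. -/
theorem AdmissibleInputs.exists_tracking (hu : AdmissibleInputs T β u)
    (hf : ∀ j, ContDiff ℝ 2 (f j)) {y : ℝ → E}
    (hy : IsIntegralCurveOn y (fun _ => averagedField f β) (Ici 0)) {τ D : ℝ} (hτ : 0 ≤ τ)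
    (hD : 0 < D) :
    ∃ r > 0, ∃ ω₀ > 0, ∀ ω > ω₀, ∀ t₀, ∀ s ∈ Icc 0 τ, ∀ x,
      IsIntegralCurveOn x (controlAffineField (fun _ => 0) f u ω) (Icc t₀ (t₀ + s)) →
      x t₀ ∈ ball (y 0) r → ∀ s' ∈ Icc 0 s, dist (x (t₀ + s')) (y s') < D := by
  obtain ⟨R₀, hR₀⟩ := (isCompact_Icc (a := 0) (b := τ)).exists_bound_of_continuousOn
    (hy.continuousOn.mono Icc_subset_Ici_self)
  obtain ⟨C, hC0, hC⟩ := hu.exists_nearIdentity_bounds hf (R₀ + D)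
  obtain ⟨L, hL⟩ := exists_lipschitzOnWith_closedBall_of_contDiff
    (contDiff_averagedField (β := β) hf) (R₀ + D)
  set Γ := gronwallBound 2 L 1 τ
  have hmono : Monotone (gronwallBound 2 L 1) :=
    gronwallBound_mono (by norm_num) (by norm_num) L.coe_nonneg
  have hΓ : 2 ≤ Γ := by
    have := hmono hτ
    rwa [gronwallBound_x0] at this
  -- `e` bounds the initial error, the transformation and the perturbation of the equation;
  -- Grönwall's inequality multiplies it by at most `Γ`
  set e := D / (2 * (Γ + 1))
  have he : 0 < e := by positivity
  have heD : e * (Γ + 1) < D := by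
    have : e * (Γ + 1) = D / 2 := by
      simp only [e]
      field_simp
    linarith
  have heD' : e < D := by nlinarith
  -- `√ω ≥ A` makes the errors of order `ω^{-1/2}`, including the factor `L`, at most `e`
  set A := (C * (L + 1)) / e with hA
  have hA0 : 0 ≤ A := by positivity
  refine ⟨e, he, max 1 (A ^ 2), by positivity, fun ω hω t₀ s hs x hx hx0 => ?_⟩
  have hω1 : 1 ≤ ω := (le_max_left _ _).trans hω.le
  have hω0 : 0 < ω := by linarith
  have hsq : A ≤ √ω := Real.le_sqrt_of_sq_le ((le_max_right _ _).trans hω.le)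
  have hs0 : 0 < √ω := Real.sqrt_pos.2 hω0
  have hsmall : C * (√ω)⁻¹ * (L + 1) ≤ e := by
    rw [hA, div_le_iff₀ he] at hsq
    have := mul_le_mul_of_nonneg_right hsq (inv_nonneg.2 hs0.le)
    have h2 : √ω * e * (√ω)⁻¹ = e := by field_simp
    linarith
  have hc0 : 0 ≤ C * (√ω)⁻¹ := by positivity
  have hsmall' : C * (√ω)⁻¹ ≤ e := by nlinarith [L.coe_nonneg, mul_nonneg hc0 L.coe_nonneg]
  have hmaps : ∀ b, MapsTo (fun r => t₀ + r) (Icc 0 b) (Icc t₀ (t₀ + b)) := fun b r hr =>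
    ⟨by linarith [hr.1], by linarith [hr.2]⟩
  have hxc : ContinuousOn (fun r => x (t₀ + r)) (Icc 0 s) :=
    hx.continuousOn.comp (by fun_prop) (hmaps s)
  have hyc : ContinuousOn y (Icc 0 s) := hy.continuousOn.mono Icc_subset_Ici_self
  have hφ0 : dist (x (t₀ + 0)) (y 0) < e := by rw [add_zero]; exact hx0
  refine forall_lt_of_bootstrap (φ := fun r => dist (x (t₀ + r)) (y r))
    (continuous_dist.comp_continuousOn (hxc.prodMk hyc))
    (hφ0.trans heD') fun b hb hle => ?_
  have hyR : ∀ r ∈ Icc 0 b, ‖y r‖ ≤ R₀ := fun r hr =>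
    hR₀ r ⟨hr.1, hr.2.trans (hb.2.trans hs.2)⟩
  have hyR' : ∀ r ∈ Icc 0 b, y r ∈ closedBall (0 : E) (R₀ + D) := fun r hr => by
    rw [mem_closedBall_zero_iff]
    linarith [hyR r hr]
  have hxR : ∀ r ∈ Icc 0 b, x (t₀ + r) ∈ closedBall (0 : E) (R₀ + D) := fun r hr => by
    rw [mem_closedBall_zero_iff]
    have h1 := hle r hr
    rw [dist_eq_norm] at h1
    have h2 := norm_le_norm_add_norm_sub' (x (t₀ + r)) (y r)
    linarith [hyR r hr]
  -- the transformed solution, shifted to initial time zero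
  set z : ℝ → E := fun r => nearIdentity f β u ω (t₀ + r) (x (t₀ + r)) with hz
  have hzx : ∀ r ∈ Icc 0 b, ‖z r - x (t₀ + r)‖ ≤ C * (√ω)⁻¹ := fun r hr =>
    (hC ω hω1 (t₀ + r) _ (hxR r hr)).1
  have hzd : ∀ r ∈ Icc 0 b, HasDerivWithinAt z (averagedField f β (x (t₀ + r)) +
      (√ω)⁻¹ • remainder f β u (ω * (t₀ + r)) (x (t₀ + r))) (Icc 0 b) r := by
    intro r hr
    have h1 := hu.hasDerivWithinAt_nearIdentity hf hω0
      ((hx.mono (Icc_subset_Icc_right (by linarith [hb.2]))) (t₀ + r) (hmaps b hr))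
    have h2 := h1.scomp r ((hasDerivWithinAt_id r (Icc 0 b)).const_add t₀) (hmaps b)
    simpa [Function.comp_def] using h2
  have hyd : ∀ r ∈ Icc 0 b, HasDerivWithinAt y (averagedField f β (y r)) (Icc 0 b) r :=
    fun r hr => (hy.mono Icc_subset_Ici_self) r hr
  have hdiff : ∀ r ∈ Icc 0 b, HasDerivWithinAt (fun r => z r - y r)
      (averagedField f β (x (t₀ + r)) + (√ω)⁻¹ • remainder f β u (ω * (t₀ + r)) (x (t₀ + r)) -
        averagedField f β (y r)) (Icc 0 b) r := fun r hr => (hzd r hr).sub (hyd r hr)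
  have hgron := norm_le_gronwallBound_of_norm_deriv_right_le (δ := e * 2) (K := L) (ε := e * 1)
    (fun r hr => (hdiff r hr).continuousWithinAt)
    (fun r hr => (hdiff r ⟨hr.1, hr.2.le⟩).mono_of_mem_nhdsWithin
      (mem_of_superset (Icc_mem_nhdsGE hr.2) (Icc_subset_Icc_left hr.1)))
    (by
      have h1 := hzx 0 ⟨le_rfl, hb.1⟩
      have h2 := norm_sub_le_norm_sub_add_norm_sub (z 0) (x (t₀ + 0)) (y 0)
      rw [dist_eq_norm] at hφ0
      linarith)
    (fun r hr => by
      have hr' : r ∈ Icc 0 b := ⟨hr.1, hr.2.le⟩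
      have h1 := (hL.dist_le_mul _ (hxR r hr') _ (hyR' r hr'))
      rw [dist_eq_norm, dist_eq_norm] at h1
      have h2 := (hC ω hω1 (t₀ + r) _ (hxR r hr')).2
      have h3 := norm_sub_le_norm_sub_add_norm_sub (x (t₀ + r)) (z r) (y r)
      have h4 := hzx r hr'
      rw [norm_sub_rev] at h4
      have h5 : ‖averagedField f β (x (t₀ + r)) +
          (√ω)⁻¹ • remainder f β u (ω * (t₀ + r)) (x (t₀ + r)) - averagedField f β (y r)‖ ≤
          ‖averagedField f β (x (t₀ + r)) - averagedField f β (y r)‖ +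
            ‖(√ω)⁻¹ • remainder f β u (ω * (t₀ + r)) (x (t₀ + r))‖ := by
        rw [add_sub_right_comm]
        exact norm_add_le _ _
      have h6 := mul_le_mul_of_nonneg_left (h3.trans (add_le_add_left h4 _)) L.coe_nonneg
      linarith)
    b ⟨hb.1, le_rfl⟩
  rw [sub_zero, gronwallBound_mul] at hgron
  have h1 : gronwallBound 2 L 1 b ≤ Γ := hmono (hb.2.trans hs.2)
  have h2 := mul_le_mul_of_nonneg_left h1 he.le
  have h3 := norm_sub_le_norm_sub_add_norm_sub (x (t₀ + b)) (z b) (y b)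
  have h4 := hzx b ⟨hb.1, le_rfl⟩
  rw [norm_sub_rev] at h4
  simp only [dist_eq_norm]
  linarith

end Tracking

/-! ### Practical stability from tracking on compact time intervals -/

section PracticalStability

variable {E : Type*} [NormedAddCommGroup E] [NormedSpace ℝ E]

/-- The solutions of `ẋ = g(ω, t, x)` track those of the autonomous system `ẏ = G(y)` on compact
time intervals, for large `ω` and uniformly in the initial time. -/
def TracksOnCompacts (g : ℝ → ℝ → E → E) (G : E → E) : Prop :=
  ∀ y, IsIntegralCurveOn y (fun _ => G) (Ici 0) → ∀ τ ≥ 0, ∀ D > 0,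
    ∃ r > 0, ∃ ω₀ > 0, ∀ ω > ω₀, ∀ t₀, ∀ s ∈ Icc 0 τ, ∀ x,
      IsIntegralCurveOn x (g ω) (Icc t₀ (t₀ + s)) →
      x t₀ ∈ ball (y 0) r → ∀ s' ∈ Icc 0 s, dist (x (t₀ + s')) (y s') < D

variable {g : ℝ → ℝ → E → E} {G : E → E} {S : Set E}

theorem IsSolution.isIntegralCurveOn {g : ℝ → E → E} {t₀ : ℝ} {x₀ : E} {x : ℝ → E}
    (hx : IsSolution g t₀ x₀ x) : IsIntegralCurveOn x g (Ici t₀) := hx.2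

omit [NormedSpace ℝ E] in
theorem mem_thickening_of_dist_lt {a b c : ℝ} {x y : E} (hxy : dist x y < a)
    (hy : y ∈ thickening b S) (hc : a + b ≤ c) : x ∈ thickening c S := by
  obtain ⟨z, hz, hyz⟩ := mem_thickening_iff.1 hy
  exact mem_thickening_iff.2 ⟨z, hz, by linarith [dist_triangle x y z]⟩

omit [NormedSpace ℝ E] in
theorem exists_thickening_subset_closedBall (hS : IsCompact S) (ε : ℝ) :
    ∃ R, thickening ε S ⊆ closedBall 0 R :=
  (hS.isBounded.thickening (δ := ε)).subset_closedBall 0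

/-- Tracking is uniform over a compact set of initial values, by a covering argument. -/
theorem TracksOnCompacts.uniform (hg : TracksOnCompacts g G) {K : Set E} (hK : IsCompact K)
    (hsol : ∀ y₀ ∈ K, ∃ y, IsSolution (fun _ => G) 0 y₀ y) {τ D : ℝ} (hτ : 0 ≤ τ) (hD : 0 < D) :
    ∃ ω₀ > 0, ∃ R, ∀ ω > ω₀, ∀ t₀, ∀ s ∈ Icc 0 τ, ∀ x,
      IsIntegralCurveOn x (g ω) (Icc t₀ (t₀ + s)) → x t₀ ∈ K →
      ∃ y₀ ∈ K, ∃ y, IsSolution (fun _ => G) 0 y₀ y ∧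
        ∀ s' ∈ Icc 0 s, dist (x (t₀ + s')) (y s') < D ∧ ‖x (t₀ + s')‖ ≤ R := by
  refine hK.induction_on (p := fun A => ∃ ω₀ > 0, ∃ R, ∀ ω > ω₀, ∀ t₀, ∀ s ∈ Icc 0 τ, ∀ x,
      IsIntegralCurveOn x (g ω) (Icc t₀ (t₀ + s)) → x t₀ ∈ A →
      ∃ y₀ ∈ K, ∃ y, IsSolution (fun _ => G) 0 y₀ y ∧
        ∀ s' ∈ Icc 0 s, dist (x (t₀ + s')) (y s') < D ∧ ‖x (t₀ + s')‖ ≤ R) ?_ ?_ ?_ ?_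
  · exact ⟨1, one_pos, 0, fun ω _ t₀ s _ x _ h => h.elim⟩
  · rintro A B hAB ⟨ω₀, hω₀, R, h⟩
    exact ⟨ω₀, hω₀, R, fun ω hω t₀ s hs x hx hxA => h ω hω t₀ s hs x hx (hAB hxA)⟩
  · rintro A B ⟨ω₁, hω₁, R₁, h₁⟩ ⟨ω₂, _, R₂, h₂⟩
    refine ⟨max ω₁ ω₂, lt_max_of_lt_left hω₁, max R₁ R₂, fun ω hω t₀ s hs x hx hxAB => ?_⟩
    rcases hxAB with hxA | hxB
    · obtain ⟨y₀, hy₀, y, hy, h⟩ := h₁ ω ((le_max_left _ _).trans_lt hω) t₀ s hs x hx hxA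
      exact ⟨y₀, hy₀, y, hy, fun s' hs' => ⟨(h s' hs').1, (h s' hs').2.trans (le_max_left _ _)⟩⟩
    · obtain ⟨y₀, hy₀, y, hy, h⟩ := h₂ ω ((le_max_right _ _).trans_lt hω) t₀ s hs x hx hxB
      exact ⟨y₀, hy₀, y, hy, fun s' hs' => ⟨(h s' hs').1, (h s' hs').2.trans (le_max_right _ _)⟩⟩
  · intro y₀ hy₀
    obtain ⟨y, hy⟩ := hsol y₀ hy₀
    obtain ⟨r, hr, ω₀, hω₀, h⟩ := hg y hy.isIntegralCurveOn τ hτ D hD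
    obtain ⟨M, hM⟩ := (isCompact_Icc (a := 0) (b := τ)).exists_bound_of_continuousOn
      (hy.isIntegralCurveOn.continuousOn.mono Icc_subset_Ici_self)
    refine ⟨ball y₀ r, mem_nhdsWithin_of_mem_nhds (ball_mem_nhds y₀ hr), ω₀, hω₀, M + D,
      fun ω hω t₀ s hs x hx hx0 => ⟨y₀, hy₀, y, hy, fun s' hs' => ?_⟩⟩
    have h1 := h ω hω t₀ s hs x hx (by rwa [hy.1]) s' hs'
    refine ⟨h1, ?_⟩
    have h2 := hM s' ⟨hs'.1, hs'.2.trans hs.2⟩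
    have h3 := norm_le_norm_add_norm_sub' (x (t₀ + s')) (y s')
    rw [dist_eq_norm] at h1
    linarith

theorem exists_solution_of_mem_cthickening {δ δ' : ℝ} (hlt : δ < δ') (hδ' : 0 < δ')
    (hatt : UniformlyAttractive (fun _ => G) S δ') :
    ∀ y₀ ∈ cthickening δ S, ∃ y, IsSolution (fun _ => G) 0 y₀ y := fun y₀ hy₀ => by
  obtain ⟨t₁, _, h⟩ := hatt 1 one_pos
  exact (h 0 le_rfl y₀ (cthickening_subset_thickening' hδ' hlt S hy₀)).1

variable [ProperSpace E]

/-- Solutions starting near `S` never leave a given neighbourhood of `S`, for large `ω`. After the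
time the autonomous system needs to contract a neighbourhood of `S` into a smaller one, a tracking
solution is back in the neighbourhood where it started, so that tracking on a compact time interval
can be iterated. -/
theorem TracksOnCompacts.exists_trapping (hg : TracksOnCompacts g G) (hS : IsCompact S)
    (hstab : UniformlyStable (fun _ => G) S) {δ' : ℝ} (hδ' : 0 < δ')
    (hatt : UniformlyAttractive (fun _ => G) S δ') {ε : ℝ} (hε : 0 < ε) :
    ∃ δ > 0, ∃ ω₀ > 0, ∀ ω > ω₀, ∀ t₀ b, t₀ ≤ b → ∀ x, IsIntegralCurveOn x (g ω) (Icc t₀ b) →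
      x t₀ ∈ thickening δ S → x b ∈ thickening ε S := by
  obtain ⟨δ₁, hδ₁, hst⟩ := hstab (ε / 2) (by positivity)
  set δ := min δ₁ δ'
  have hδ : 0 < δ := lt_min hδ₁ hδ'
  obtain ⟨t₁, ht₁, hat⟩ := hatt (δ / 4) (by positivity)
  have hsub : cthickening (δ / 2) S ⊆ thickening δ S :=
    cthickening_subset_thickening' hδ (by linarith) S
  obtain ⟨ω₀, hω₀, R, h⟩ := hg.uniform (hS.cthickening (r := δ / 2))
    (exists_solution_of_mem_cthickening ((half_lt_self hδ).trans_le (min_le_right _ _)) hδ' hatt)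
    (τ := t₁ + 1) (D := min (ε / 2) (δ / 4)) (by positivity) (by positivity)
  refine ⟨δ / 2, by positivity, ω₀, hω₀, fun ω hω => ?_⟩
  have hstep : ∀ t₀, ∀ s ∈ Icc 0 (t₁ + 1), ∀ x, IsIntegralCurveOn x (g ω) (Icc t₀ (t₀ + s)) →
      x t₀ ∈ thickening (δ / 2) S → x (t₀ + s) ∈ thickening ε S ∧
        (t₁ ≤ s → x (t₀ + s) ∈ thickening (δ / 2) S) := by
    intro t₀ s hs x hx hx0
    obtain ⟨y₀, hy₀, y, hy, hxy⟩ := h ω hω t₀ s hs x hx (thickening_subset_cthickening _ _ hx0)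
    have hd := (hxy s ⟨hs.1, le_rfl⟩).1
    have hy1 := (hst 0 le_rfl y₀ (thickening_mono (min_le_left _ _) S (hsub hy₀))).2 y hy s
      (by linarith [hs.1])
    refine ⟨mem_thickening_of_dist_lt hd hy1 (by linarith [min_le_left (ε / 2) (δ / 4)]),
      fun hts => ?_⟩
    have hy2 := (hat 0 le_rfl y₀ (thickening_mono (min_le_right _ _) S (hsub hy₀))).2 y hy s
      (by linarith)
    exact mem_thickening_of_dist_lt hd hy2 (by linarith [min_le_right (ε / 2) (δ / 4)])
  have hiter : ∀ k : ℕ, ∀ t₀ b, t₀ ≤ b → b ≤ t₀ + k * (t₁ + 1) → ∀ x,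
      IsIntegralCurveOn x (g ω) (Icc t₀ b) → x t₀ ∈ thickening (δ / 2) S →
      x b ∈ thickening ε S := by
    intro k
    induction k with
    | zero =>
      intro t₀ b htb hb x hx hx0
      have hb' : b = t₀ + 0 := le_antisymm (by simpa using hb) (by simpa using htb)
      rw [hb'] at hx ⊢
      exact (hstep t₀ 0 ⟨le_rfl, by positivity⟩ x hx hx0).1
    | succ k ih =>
      intro t₀ b htb hb x hx hx0
      rcases le_total b (t₀ + (t₁ + 1)) with hle | hle
      · have hb' : b = t₀ + (b - t₀) := by ring
        rw [hb'] at hx ⊢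
        exact (hstep t₀ (b - t₀) ⟨by linarith, by linarith⟩ x hx hx0).1
      · refine ih (t₀ + (t₁ + 1)) b hle (by push_cast at hb; linarith) x
          (hx.mono (Icc_subset_Icc_left (by linarith))) ?_
        exact (hstep t₀ (t₁ + 1) ⟨by positivity, le_rfl⟩ x
          (hx.mono (Icc_subset_Icc_right hle)) hx0).2 (by linarith)
  intro t₀ b htb x hx hx0
  obtain ⟨k, hk⟩ := exists_nat_ge ((b - t₀) / (t₁ + 1))
  rw [div_le_iff₀ (by positivity)] at hk
  exact hiter k t₀ b htb (by linarith) x hx hx0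

theorem TracksOnCompacts.practicallyUniformlyStable (hg : TracksOnCompacts g G)
    (hlip : ∀ ω, LocallyLipschitzField (g ω)) (hS : IsCompact S)
    (hstab : UniformlyStable (fun _ => G) S) {δ' : ℝ} (hδ' : 0 < δ')
    (hatt : UniformlyAttractive (fun _ => G) S δ') : PracticallyUniformlyStable g S := by
  intro ε hε
  obtain ⟨δ, hδ, ω₀, hω₀, h⟩ := hg.exists_trapping hS hstab hδ' hatt hε
  obtain ⟨R, hR⟩ := exists_thickening_subset_closedBall hS ε
  refine ⟨δ, hδ, ω₀, hω₀, fun t₀ _ ω hω x₀ hx₀ => ⟨?_, fun x hx t ht => ?_⟩⟩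
  · exact (hlip ω).exists_isSolution (R := R) fun b hb x hx0 hx =>
      hR (h ω hω t₀ b hb x hx (by rwa [hx0]))
  · rw [add_zero] at ht
    exact h ω hω t₀ t ht x (hx.isIntegralCurveOn.mono Icc_subset_Ici_self) (by rwa [hx.1])

theorem TracksOnCompacts.practicallyUniformlyAttractive (hg : TracksOnCompacts g G)
    (hlip : ∀ ω, LocallyLipschitzField (g ω)) (hS : IsCompact S)
    (hstab : UniformlyStable (fun _ => G) S) {δ δ' : ℝ} (hδ' : 0 < δ') (hlt : δ < δ')
    (hatt : UniformlyAttractive (fun _ => G) S δ') : PracticallyUniformlyAttractive g S δ := by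
  intro ε hε
  obtain ⟨δ₁, hδ₁, ω₁, hω₁, htrap⟩ := hg.exists_trapping hS hstab hδ' hatt hε
  obtain ⟨t₁, ht₁, hat⟩ := hatt (δ₁ / 2) (by positivity)
  obtain ⟨ω₂, hω₂, R, h⟩ := hg.uniform (hS.cthickening (r := δ))
    (exists_solution_of_mem_cthickening hlt hδ' hatt) (τ := t₁) (D := δ₁ / 2) ht₁ (by positivity)
  obtain ⟨R', hR'⟩ := exists_thickening_subset_closedBall hS ε
  refine ⟨t₁, ht₁, max ω₁ ω₂, lt_max_of_lt_left hω₁, fun t₀ _ ω hω x₀ hx₀ => ?_⟩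
  have hω1 : ω > ω₁ := (le_max_left _ _).trans_lt hω
  have hω2 : ω > ω₂ := (le_max_right _ _).trans_lt hω
  have hK : ∀ x : ℝ → E, x t₀ = x₀ → x t₀ ∈ cthickening δ S := fun x hx => by
    rw [hx]
    exact thickening_subset_cthickening _ _ hx₀
  have hlate : ∀ b ≥ t₀ + t₁, ∀ x, x t₀ = x₀ → IsIntegralCurveOn x (g ω) (Icc t₀ b) →
      x b ∈ thickening ε S := by
    intro b hb x hx0 hx
    obtain ⟨y₀, hy₀, y, hy, hxy⟩ := h ω hω2 t₀ t₁ ⟨ht₁, le_rfl⟩ x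
      (hx.mono (Icc_subset_Icc_right hb)) (hK x hx0)
    have hyt := (hat 0 le_rfl y₀ (cthickening_subset_thickening' hδ' hlt S hy₀)).2 y hy t₁
      (by linarith)
    exact htrap ω hω1 (t₀ + t₁) b hb x (hx.mono (Icc_subset_Icc_left (by linarith)))
      (mem_thickening_of_dist_lt (hxy t₁ ⟨ht₁, le_rfl⟩).1 hyt (by linarith))
  refine ⟨(hlip ω).exists_isSolution (R := max R R') fun b hb x hx0 hx => ?_, fun x hx t ht =>
    hlate t ht x hx.1 (hx.isIntegralCurveOn.mono Icc_subset_Ici_self)⟩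
  rcases le_total b (t₀ + t₁) with hle | hle
  · have hb' : b = t₀ + (b - t₀) := by ring
    rw [hb'] at hx ⊢
    have hs : 0 ≤ b - t₀ := by linarith
    obtain ⟨y₀, hy₀, y, hy, hxy⟩ := h ω hω2 t₀ (b - t₀) ⟨hs, by linarith⟩ x hx (hK x hx0)
    exact mem_closedBall_zero_iff.2 ((hxy _ ⟨hs, le_rfl⟩).2.trans (le_max_left _ _))
  · exact closedBall_subset_closedBall (le_max_right _ _) (hR' (hlate b hle x hx0 hx))

theorem TracksOnCompacts.locallyPracticallyUAS (hg : TracksOnCompacts g G)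
    (hlip : ∀ ω, LocallyLipschitzField (g ω)) (hS : IsCompact S)
    (h : LocallyUAS (fun _ => G) S) : LocallyPracticallyUAS g S := by
  obtain ⟨hstab, δ', hδ', hatt⟩ := h
  exact ⟨hg.practicallyUniformlyStable hlip hS hstab hδ' hatt, δ' / 2, half_pos hδ',
    hg.practicallyUniformlyAttractive hlip hS hstab hδ' (half_lt_self hδ') hatt⟩

theorem TracksOnCompacts.semiGloballyPracticallyUAS (hg : TracksOnCompacts g G)
    (hlip : ∀ ω, LocallyLipschitzField (g ω)) (hS : IsCompact S)
    (h : GloballyUAS (fun _ => G) S) : SemiGloballyPracticallyUAS g S := by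
  obtain ⟨hstab, hatt⟩ := h
  refine ⟨hg.practicallyUniformlyStable hlip hS hstab one_pos (hatt 1 one_pos), fun δ hδ => ?_⟩
  exact hg.practicallyUniformlyAttractive hlip hS hstab (by linarith) (lt_add_one δ)
    (hatt (δ + 1) (by linarith))

end PracticalStability

/-! ### The extremum seeking system -/

/-- The class relation makes the Wronskian `F₁ F₂' - F₁' F₂` equal to `-F₀`: by differentiation off
the zeros of `F₁`, and at a zero by continuity, since it is isolated. -/
theorem ClassRelation.wronskian {F₀ F₁ F₂ : ℝ → ℝ} (h : ClassRelation F₀ F₁ F₂)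
    (h₀ : Continuous F₀) (h₁ : ContDiff ℝ 1 F₁) (h₂ : ContDiff ℝ 1 F₂) (z : ℝ) :
    F₁ z * deriv F₂ z - deriv F₁ z * F₂ z = -F₀ z := by
  obtain ⟨-, hiso, Ψ, hΨ, -⟩ := h
  have hreg : ∀ z, F₁ z ≠ 0 → F₁ z * deriv F₂ z - deriv F₁ z * F₂ z = -F₀ z := by
    intro z hz
    have hF₁ : HasDerivAt F₁ (deriv F₁ z) z := (h₁.differentiable (by norm_num) z).hasDerivAt
    have hF₂ : HasDerivAt F₂ (-(deriv F₁ z * Ψ z + F₁ z * (F₀ z / F₁ z ^ 2))) z := by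
      refine ((hF₁.mul (hΨ z hz).1).neg).congr_of_eventuallyEq ?_
      filter_upwards [h₁.continuous.continuousAt.eventually_ne hz] with w hw
      exact (hΨ w hw).2
    rw [hF₂.deriv, (hΨ z hz).2]
    field_simp
    ring
  by_cases hz : F₁ z = 0
  · have hc : Continuous fun z => F₁ z * deriv F₂ z - deriv F₁ z * F₂ z :=
      (h₁.continuous.mul (h₂.continuous_deriv (by norm_num))).sub
        ((h₁.continuous_deriv (by norm_num)).mul h₂.continuous)
    refine tendsto_nhds_unique_of_eventuallyEq ((hc.tendsto z).mono_left nhdsWithin_le_nhds)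
      ((h₀.neg.tendsto z).mono_left (nhdsWithin_le_nhds (s := {z}ᶜ))) ?_
    filter_upwards [hiso z hz] with w hw using hreg w hw
  · exact hreg z hz

variable {n : ℕ} {J : EuclideanSpace ℝ (Fin n) → ℝ} {F : Fin 2 → Fin n → ℝ → ℝ}

theorem contDiff_esVectorField {m : WithTop ℕ∞} (hJ : ContDiff ℝ m J)
    (hF : ∀ s i, ContDiff ℝ m (F s i)) (p : InputIndex n) :
    ContDiff ℝ m (esVectorField J F p) :=
  ((hF _ _).comp hJ).smul contDiff_const

theorem fderiv_esVectorField {x : EuclideanSpace ℝ (Fin n)} (hJ : DifferentiableAt ℝ J x)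
    (hF : ∀ s i, Differentiable ℝ (F s i)) (p : InputIndex n) (v : EuclideanSpace ℝ (Fin n)) :
    fderiv ℝ (esVectorField J F p) x v =
      (deriv (F (ofLex p).1 (ofLex p).2) (J x) * fderiv ℝ J x v) • unitVec (ofLex p).2 := by
  have h1 := (hF (ofLex p).1 (ofLex p).2 (J x)).hasDerivAt.comp_hasFDerivAt x hJ.hasFDerivAt
  have h2 := h1.smul_const (unitVec (n := n) (ofLex p).2)
  have h3 : fderiv ℝ (esVectorField J F p) x = _ := h2.fderiv
  rw [h3]
  simp

theorem lieBracket_esVectorField {x : EuclideanSpace ℝ (Fin n)} (hJ : DifferentiableAt ℝ J x)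
    (hF : ∀ s i, Differentiable ℝ (F s i)) (i : Fin n) :
    VectorField.lieBracket ℝ (esVectorField J F (idx 0 i)) (esVectorField J F (idx 1 i)) x =
      ((F 0 i (J x) * deriv (F 1 i) (J x) - deriv (F 0 i) (J x) * F 1 i (J x)) *
        fderiv ℝ J x (unitVec i)) • unitVec i := by
  rw [VectorField.lieBracket, fderiv_esVectorField hJ hF, fderiv_esVectorField hJ hF]
  simp only [esVectorField, ofLex_toLex, map_smul, smul_eq_mul]
  rw [← sub_smul]
  congr 1
  ring

theorem lieBracketField_esVectorField (hJ : Differentiable ℝ J)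
    (hF : ∀ s i, ContDiff ℝ 1 (F s i)) {F₀ : Fin n → ℝ → ℝ} (hF₀ : ∀ i, Continuous (F₀ i))
    (hclass : ∀ i, ClassRelation (F₀ i) (F 0 i) (F 1 i))
    {β : InputIndex n → InputIndex n → ℝ}
    (hβ : ∀ (s r : Fin 2) (i k : Fin n), i ≠ k → β (idx s i) (idx r k) = 0)
    (x : EuclideanSpace ℝ (Fin n)) :
    lieBracketField (fun _ => 0) (esVectorField J F) β x = gradientLikeField J F₀ β x := by
  have hsum : ∀ H : InputIndex n → EuclideanSpace ℝ (Fin n),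
      ∑ p, H p = ∑ s, ∑ i, H (idx s i) := fun H => by
    rw [← Fintype.sum_prod_type']
    exact (Equiv.sum_comp (toLex : Fin 2 × Fin n ≃ InputIndex n) H).symm
  have hone : ∀ (s r : Fin 2) (i : Fin n) (b : Fin 2 → Fin n → EuclideanSpace ℝ (Fin n)),
      (∑ k, if idx s i < idx r k then β (idx r k) (idx s i) • b r k else 0) =
        if s < r then β (idx r i) (idx s i) • b r i else 0 := by
    intro s r i b
    rw [Finset.sum_eq_single i]
    · simp [idx, Prod.Lex.toLex_lt_toLex]
    · intro k _ hk
      rw [hβ r s k i hk, zero_smul, ite_self]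
    · simp
  have hinner : ∀ (s : Fin 2) (i : Fin n),
      (∑ r, ∑ k, if idx s i < idx r k then β (idx r k) (idx s i) •
        VectorField.lieBracket ℝ (esVectorField J F (idx s i)) (esVectorField J F (idx r k)) x
        else 0) =
      ∑ r, if s < r then β (idx r i) (idx s i) •
        VectorField.lieBracket ℝ (esVectorField J F (idx s i)) (esVectorField J F (idx r i)) x
        else 0 := fun s i => Finset.sum_congr rfl fun r _ => hone s r i fun r k =>
    VectorField.lieBracket ℝ (esVectorField J F (idx s i)) (esVectorField J F (idx r k)) x
  simp only [lieBracketField, gradientLikeField, zero_add, Finset.sum_filter, hsum]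
  simp only [hinner, Fin.sum_univ_two, lt_irrefl, if_false, zero_lt_one, if_true, not_lt_zero,
    add_zero, zero_add, Finset.sum_const_zero]
  rw [← Finset.sum_neg_distrib]
  refine Finset.sum_congr rfl fun i _ => ?_
  rw [lieBracket_esVectorField (hJ x) fun s i => (hF s i).differentiable (by norm_num),
    (hclass i).wronskian (hF₀ i) (hF 0 i) (hF 1 i), smul_smul, ← neg_smul]
  congr 1
  ring

end LieBracketES

end

theorem theorem2 {n : ℕ}
    (J : EuclideanSpace ℝ (Fin n) → ℝ) (hJ : ContDiff ℝ 2 J)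
    (F : Fin 2 → Fin n → ℝ → ℝ) (hF : ∀ s i, ContDiff ℝ 1 (F s i))
    (F₀ : Fin n → ℝ → ℝ) (hF₀ : ∀ i, Continuous (F₀ i))
    (hclass : ∀ i, LieBracketES.ClassRelation (F₀ i) (F 0 i) (F 1 i))
    (T : ℝ) (β : LieBracketES.InputIndex n → LieBracketES.InputIndex n → ℝ)
    (u : LieBracketES.InputIndex n → ℝ → ℝ)
    (hu : LieBracketES.AdmissibleInputs T β u)
    (hβ : ∀ (s r : Fin 2) (i k : Fin n), i ≠ k →
      β (LieBracketES.idx s i) (LieBracketES.idx r k) = 0) :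
    (∀ x, LieBracketES.lieBracketField (fun _ => 0) (LieBracketES.esVectorField J F) β x =
      LieBracketES.gradientLikeField J F₀ β x) ∧
    ((∀ s i, ContDiff ℝ 2 (F s i)) →
      ∀ S : Set (EuclideanSpace ℝ (Fin n)), IsCompact S →
        (LieBracketES.LocallyUAS (fun _ => LieBracketES.gradientLikeField J F₀ β) S →
          LieBracketES.LocallyPracticallyUAS
            (fun ω => LieBracketES.esField J F (LieBracketES.scaledInput u ω)) S) ∧
        (LieBracketES.GloballyUAS (fun _ => LieBracketES.gradientLikeField J F₀ β) S →
          LieBracketES.SemiGloballyPracticallyUAS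
            (fun ω => LieBracketES.esField J F (LieBracketES.scaledInput u ω)) S)) := by
  have hbracket := LieBracketES.lieBracketField_esVectorField (hJ.differentiable (by norm_num)) hF
    hF₀ hclass hβ
  refine ⟨hbracket, fun hF2 S hS => ?_⟩
  have hf := LieBracketES.contDiff_esVectorField hJ hF2
  have hfield : (fun ω => LieBracketES.esField J F (LieBracketES.scaledInput u ω)) =
      LieBracketES.controlAffineField (fun _ => 0) (LieBracketES.esVectorField J F) u := by
    funext ω t x
    exact LieBracketES.esField_eq_controlAffineField J F u ω t x
  have havg : LieBracketES.gradientLikeField J F₀ β =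
      LieBracketES.averagedField (LieBracketES.esVectorField J F) β := by
    funext x
    rw [← hbracket, LieBracketES.lieBracketField_eq_averagedField hu.beta_antisymm]
  have htrack : LieBracketES.TracksOnCompacts
      (LieBracketES.controlAffineField (fun _ => 0) (LieBracketES.esVectorField J F) u)
      (LieBracketES.averagedField (LieBracketES.esVectorField J F) β) :=
    fun y hy τ hτ D hD => hu.exists_tracking hf hy hτ hD
  have hlip := hu.locallyLipschitzField_controlAffineField
    (fun j => (hf j).of_le (by norm_num))
  rw [hfield, havg]
  exact ⟨htrack.locallyPracticallyUAS hlip hS, htrack.semiGloballyPracticallyUAS hlip hS⟩
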